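/- Let $\Sigma=(O,\mathrm{ar})$ be an algebraic signature, i.e. a set $O$ of operations with an arity function $\mathrm{ar}:O\to\mathbb N$. A hypergraph $\mathcal G=(E,V,s,t)$ consists of a set $E$ of hyperedges, a set $V$ of nodes and functions $s,t:E\to V^\star$ to the set of finite words on $V$; a morphism $\mathcal G\to\mathcal H$ is a pair of functions $h:E_{\mathcal G}\to E_{\mathcal H}$, $k:V_{\mathcal G}\to V_{\mathcal H}$ with $s_{\mathcal H}\circ h=k^\star\circ s_{\mathcal G}$ and $t_{\mathcal H}\circ h=k^\star\circ t_{\mathcal G}$. Let $\mathcal G^\Sigma$ be the hypergraph with a single node $v$, with $O$ as set of hyperedges, $s(o)=v^{\mathrm{ar}(o)}$ and $t(o)=v$. The category $\mathbf{Hyp}_\Sigma$ of labelled hypergraphs is the slice category $\mathbf{Hyp}/\mathcal G^\Sigma$, and the category $\mathbf{TG}_\Sigma$ of term graphs is its full subcategory on those $l:\mathcal G\to\mathcal G^\Sigma$ such that, for all hyperedges $h_1,h_2$ of $\mathcal G$, $t_{\mathcal G}(h_1)=t_{\mathcal G}(h_2)$ implies $h_1=h_2$. Then $\mathbf{TG}_\Sigma$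 is quasi-adhesive, i.e. $\mathcal M,\mathcal N$-adhesive for $\mathcal M$ the class of regular monomorphisms and $\mathcal N$ the class of all morphisms. Explicitly: regular monomorphisms contain all isomorphisms, are closed under composition and decomposition (if $g\circ f$ and $g$ are regular monomorphisms, so is $f$), and are stable under pullbacks and pushouts; every cospan $C\to D\xleftarrow{m}B$ with $m$ a regular monomorphism has a pullback; every span $C\xleftarrow{m}A\to B$ with $m$ a regular monomorphism has a pushout; and every such pushout is a Van Kampen square, i.e. in every commutative cube having it as bottom face and pullbacks as back faces, the top face is a pushout if and only if the front faces are pullbacks. -/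

import Mathlib

open CategoryTheory CategoryTheory.Limits

universe u v w

/-! ### Adhesivity relative to two classes of morphisms -/

section Adhesivity

/-- `C` is `M, N`-adhesive, for two classes `M` and `N` of morphisms of `C`. -/
structure IsMNAdhesive {C : Type w} [Category.{v} C] (M N : MorphismProperty C) : Prop where
  /-- `M` consists of monomorphisms. -/
  mono : M ≤ MorphismProperty.monomorphisms C
  /-- (i) both classes contain the isomorphisms ... -/
  isos_left : MorphismProperty.isomorphisms C ≤ M
  isos_right : MorphismProperty.isomorphisms C ≤ N
  /-- ... are closed under composition ... -/
  comp_left : M.IsStableUnderComposition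
  comp_right : N.IsStableUnderComposition
  /-- ... and under decomposition: if `f ≫ g` and `g` are in the class, so is `f`. -/
  decomp_left : M.HasOfPostcompProperty M
  decomp_right : N.HasOfPostcompProperty N
  /-- (ii) if `f ≫ g` is in `N` and `g` is in `M`, then `f` is in `N`. -/
  decomp_right_left : N.HasOfPostcompProperty M
  /-- (iii) both classes are stable under pullbacks and pushouts. -/
  pullback_left : M.IsStableUnderBaseChange
  pullback_right : N.IsStableUnderBaseChange
  pushout_left : M.IsStableUnderCobaseChange
  pushout_right : N.IsStableUnderCobaseChange
  /-- (a) pullbacks along morphisms in `M` exist. -/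
  hasPullback : ∀ {B D E : C} (g : E ⟶ D) (m : B ⟶ D), M m → HasPullback g m
  /-- (b) pushouts of a morphism in `M` and a morphism in `N` exist. -/
  hasPushout : ∀ {A B E : C} (m : A ⟶ E) (n : A ⟶ B), M m → N n → HasPushout m n
  /-- (c) such pushouts are Van Kampen squares. -/
  vanKampen : ∀ {A B E D : C} {m : A ⟶ E} {n : A ⟶ B} {g : E ⟶ D} {f : B ⟶ D}
    (H : IsPushout m n g f), M m → N n → H.IsVanKampen

/-- A quasi-adhesive category: adhesive with respect to the class of regular monomorphisms and
the class of all morphisms. -/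
def IsQuasiAdhesive (C : Type w) [Category.{v} C] : Prop :=
  IsMNAdhesive (MorphismProperty.regularMono C) (⊤ : MorphismProperty C)

end Adhesivity

/-! ### Hypergraphs -/

/-- A (directed) hypergraph: every hyperedge has a word of sources and a word of targets. -/
structure DirHypergraph : Type (u + 1) where
  /-- the hyperedges -/
  E : Type u
  /-- the nodes -/
  V : Type u
  /-- the word of sources of a hyperedge -/
  src : E → List V
  /-- the word of targets of a hyperedge -/
  tgt : E → List V

namespace DirHypergraph

/-- A morphism of hypergraphs. -/
@[ext]
structure Hom (G H : DirHypergraph.{u}) : Type u where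
  /-- the action on hyperedges -/
  onE : G.E → H.E
  /-- the action on nodes -/
  onV : G.V → H.V
  src_comm : ∀ e, H.src (onE e) = (G.src e).map onV
  tgt_comm : ∀ e, H.tgt (onE e) = (G.tgt e).map onV

/-- The identity morphism. -/
def Hom.id (G : DirHypergraph.{u}) : Hom G G where
  onE e := e
  onV x := x
  src_comm e := by simp
  tgt_comm e := by simp

/-- Composition of morphisms, in diagrammatic order. -/
def Hom.comp {G H K : DirHypergraph.{u}} (f : Hom G H) (g : Hom H K) : Hom G K where
  onE e := g.onE (f.onE e)
  onV x := g.onV (f.onV x)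
  src_comm e := by rw [g.src_comm, f.src_comm, List.map_map]; rfl
  tgt_comm e := by rw [g.tgt_comm, f.tgt_comm, List.map_map]; rfl

/-- The category of hypergraphs. -/
instance : Category.{u} DirHypergraph.{u} where
  Hom := Hom
  id := Hom.id
  comp := Hom.comp

end DirHypergraph

/-! ### Labelled hypergraphs and term graphs -/

/-- An algebraic signature: a set of operations, each with an arity. -/
structure AlgebraicSignature : Type (u + 1) where
  /-- the operations -/
  Op : Type u
  /-- the arity function -/
  arity : Op → ℕ

/-- The hypergraph of a signature: it has a single node `v`, its hyperedges are the operations,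
the source of `o` is the word consisting of `arity o` copies of `v`, and its target is the
one-letter word `v`. -/
def AlgebraicSignature.hypergraph (S : AlgebraicSignature.{u}) : DirHypergraph.{u} where
  E := S.Op
  V := PUnit.{u + 1}
  src o := List.replicate (S.arity o) PUnit.unit
  tgt _ := [PUnit.unit]

/-- The category of hypergraphs labelled by a signature, a slice category. -/
abbrev LabelledHypergraph (S : AlgebraicSignature.{u}) : Type (u + 1) :=
  Over S.hypergraph

/-- A labelled hypergraph is a term graph if hyperedges with equal targets are equal. -/
def isTermGraph (S : AlgebraicSignature.{u}) : ObjectProperty (LabelledHypergraph S) :=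
  fun G => ∀ e₁ e₂ : G.left.E, G.left.tgt e₁ = G.left.tgt e₂ → e₁ = e₂

/-- The category of term graphs, a full subcategory of that of labelled hypergraphs. -/
abbrev TermGraph (S : AlgebraicSignature.{u}) : Type (u + 1) :=
  (isTermGraph S).FullSubcategory

/-! A term graph amounts to a set of nodes on which some nodes are defined: such a node carries a
unique label and source word. A morphism is therefore determined by its action on nodes, and
preserves edges. Limits and colimits can be studied through `nodes` plus bookkeeping of definedness.
A square is a pullback iff it is one on nodes and a node is defined as soon as both its projections
are (`isPullback_iff`). Regular monomorphisms are exactly the node-injective maps that reflect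
definedness (`isRegularMono_iff`). Along such a map, gluing node sets never puts two different edges
on one node, so pushouts exist; they are the node pushouts in which every edge comes from a leg
(`isPushout_iff`). The Van Kampen property then splits: the node part is adhesivity of sets, and the
definedness part is a direct check (`isVanKampen_of_isFull`). -/

namespace TermGraph

variable {S : AlgebraicSignature.{u}}

/-- The nodes of a term graph. -/
def Node (X : TermGraph S) : Type u := X.obj.left.V

/-- The action on nodes of a morphism of term graphs. -/
def node {X Y : TermGraph S} (f : X ⟶ Y) : Node X → Node Y :=
  DirHypergraph.Hom.onV f.hom.left

/-- `Step X x o l` means that `X` has a hyperedge with label `o`, source `l` and target `x`. -/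
def Step (X : TermGraph S) (x : Node X) (o : S.Op) (l : List (Node X)) : Prop :=
  ∃ e : X.obj.left.E, X.obj.left.tgt e = [x] ∧ X.obj.left.src e = l ∧
    DirHypergraph.Hom.onE X.obj.hom e = o

/-- A node is defined if it is the target of a hyperedge. -/
def Defined (X : TermGraph S) (x : Node X) : Prop := ∃ o l, Step X x o l

lemma Step.defined {X : TermGraph S} {x : Node X} {o : S.Op} {l : List (Node X)}
    (h : Step X x o l) : Defined X x := ⟨o, l, h⟩

lemma Step.functional {X : TermGraph S} {x : Node X} {o o' : S.Op} {l l' : List (Node X)}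
    (h : Step X x o l) (h' : Step X x o' l') : o = o' ∧ l = l' := by
  obtain ⟨e, ht, rfl, rfl⟩ := h
  obtain ⟨e', ht', rfl, rfl⟩ := h'
  obtain rfl := X.property e e' (ht.trans ht'.symm)
  exact ⟨rfl, rfl⟩

lemma Step.length {X : TermGraph S} {x : Node X} {o : S.Op} {l : List (Node X)}
    (h : Step X x o l) : l.length = S.arity o := by
  obtain ⟨e, -, rfl, rfl⟩ := h
  have := congrArg List.length (DirHypergraph.Hom.src_comm X.obj.hom e)
  rw [List.length_map] at this
  exact this.symm.trans List.length_replicate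

lemma exists_tgt_eq (X : TermGraph S) (e : X.obj.left.E) :
    ∃ x : Node X, X.obj.left.tgt e = [x] := by
  have := congrArg List.length (DirHypergraph.Hom.tgt_comm X.obj.hom e)
  rw [List.length_map] at this
  exact List.length_eq_one_iff.1 this.symm

lemma onE_label {X Y : TermGraph S} (f : X ⟶ Y) (e : X.obj.left.E) :
    DirHypergraph.Hom.onE Y.obj.hom (DirHypergraph.Hom.onE f.hom.left e) =
      DirHypergraph.Hom.onE X.obj.hom e :=
  congrArg (fun k => DirHypergraph.Hom.onE k e) (Over.w f.hom)

lemma Step.map {X Y : TermGraph S} (f : X ⟶ Y) {x : Node X} {o : S.Op} {l : List (Node X)}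
    (h : Step X x o l) : Step Y (node f x) o (l.map (node f)) := by
  obtain ⟨e, ht, rfl, rfl⟩ := h
  refine ⟨DirHypergraph.Hom.onE f.hom.left e, ?_, DirHypergraph.Hom.src_comm f.hom.left e,
    onE_label f e⟩
  rw [DirHypergraph.Hom.tgt_comm f.hom.left e, ht]
  rfl

lemma Defined.map {X Y : TermGraph S} (f : X ⟶ Y) {x : Node X} (h : Defined X x) :
    Defined Y (node f x) := by
  obtain ⟨o, l, h⟩ := h
  exact (h.map f).defined

/-- By uniqueness of the edge at `node f x`, an edge downstairs lifts as soon as `x` is defined;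
this is why tracking definedness suffices. -/
lemma Defined.step_of_map {X Y : TermGraph S} {f : X ⟶ Y} {x : Node X} (h : Defined X x)
    {o : S.Op} {l : List (Node Y)} (h' : Step Y (node f x) o l) :
    ∃ l₀, Step X x o l₀ ∧ l₀.map (node f) = l := by
  obtain ⟨o₀, l₀, h⟩ := h
  obtain ⟨rfl, rfl⟩ := (h.map f).functional h'
  exact ⟨l₀, h, rfl⟩

lemma node_comp {X Y Z : TermGraph S} (f : X ⟶ Y) (g : Y ⟶ Z) (x : Node X) :
    node (f ≫ g) x = node g (node f x) := rfl

lemma node_hom_inv {X Y : TermGraph S} (e : X ≅ Y) (x : Node X) :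
    node e.inv (node e.hom x) = x :=
  congrArg (node · x) e.hom_inv_id

lemma node_inv_hom {X Y : TermGraph S} (e : X ≅ Y) (y : Node Y) :
    node e.hom (node e.inv y) = y :=
  congrArg (node · y) e.inv_hom_id

lemma hom_ext {X Y : TermGraph S} {f g : X ⟶ Y} (h : ∀ x, node f x = node g x) : f = g := by
  have hV : DirHypergraph.Hom.onV f.hom.left = DirHypergraph.Hom.onV g.hom.left := funext h
  refine ObjectProperty.hom_ext _ (Over.OverMorphism.ext (DirHypergraph.Hom.ext ?_ hV))
  funext e
  refine Y.property _ _ ?_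
  rw [DirHypergraph.Hom.tgt_comm, DirHypergraph.Hom.tgt_comm, hV]

/-- A function between nodes that preserves hyperedges underlies a morphism of term graphs. -/
lemma exists_hom {X Y : TermGraph S} (k : Node X → Node Y)
    (hk : ∀ x o l, Step X x o l → Step Y (k x) o (l.map k)) :
    ∃ f : X ⟶ Y, ∀ x, node f x = k x := by
  have key : ∀ e : X.obj.left.E, ∃ e' : Y.obj.left.E,
      Y.obj.left.tgt e' = (X.obj.left.tgt e).map k ∧ Y.obj.left.src e' = (X.obj.left.src e).map k ∧
        DirHypergraph.Hom.onE Y.obj.hom e' = DirHypergraph.Hom.onE X.obj.hom e := by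
    intro e
    obtain ⟨x, hx⟩ := exists_tgt_eq X e
    obtain ⟨e', h₁, h₂, h₃⟩ := hk x _ _ ⟨e, hx, rfl, rfl⟩
    exact ⟨e', by rw [h₁, hx]; rfl, h₂, h₃⟩
  choose kE h₁ h₂ h₃ using key
  let φ : X.obj.left ⟶ Y.obj.left := ({ onE := kE, onV := k, src_comm := h₂, tgt_comm := h₁ } :
    DirHypergraph.Hom _ _)
  exact ⟨ObjectProperty.homMk (Over.homMk φ (DirHypergraph.Hom.ext (funext h₃) rfl)), fun x => rfl⟩

/-- The morphism of term graphs given by a function between nodes preserving hyperedges. -/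
noncomputable def homMk {X Y : TermGraph S} (k : Node X → Node Y)
    (hk : ∀ x o l, Step X x o l → Step Y (k x) o (l.map k)) : X ⟶ Y :=
  (exists_hom k hk).choose

@[simp]
lemma node_homMk {X Y : TermGraph S} (k : Node X → Node Y)
    (hk : ∀ x o l, Step X x o l → Step Y (k x) o (l.map k)) (x : Node X) :
    node (homMk k hk) x = k x :=
  (exists_hom k hk).choose_spec x

/-- The hypergraph with given nodes and hyperedges given by a relation. -/
def relHypergraph (V : Type u) (R : V → S.Op → List V → Prop) : DirHypergraph.{u} where
  E := { p : V × S.Op × List V // R p.1 p.2.1 p.2.2 }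
  V := V
  src e := e.1.2.2
  tgt e := [e.1.1]

/-- The labelling of the hypergraph given by a relation compatible with arities. -/
def relLabel (V : Type u) (R : V → S.Op → List V → Prop)
    (hl : ∀ x o l, R x o l → l.length = S.arity o) :
    DirHypergraph.Hom (relHypergraph V R) S.hypergraph where
  onE e := e.1.2.1
  onV _ := PUnit.unit
  src_comm := fun ⟨_, e⟩ => (List.map_const'.trans
    (congrArg (List.replicate · PUnit.unit) (hl _ _ _ e))).symm
  tgt_comm _ := rfl

/-- The term graph with given nodes and hyperedges given by a functional relation. -/
def ofRel (V : Type u) (R : V → S.Op → List V → Prop)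
    (hR : ∀ x o l o' l', R x o l → R x o' l' → o = o' ∧ l = l')
    (hl : ∀ x o l, R x o l → l.length = S.arity o) : TermGraph S where
  obj := Over.mk (Y := relHypergraph V R) (relLabel V R hl)
  property := by
    rintro ⟨⟨x, o, l⟩, h⟩ ⟨⟨x', o', l'⟩, h'⟩ hx
    obtain rfl : x = x' := List.singleton_inj.1 hx
    obtain ⟨rfl, rfl⟩ := hR _ _ _ _ _ h h'
    rfl

lemma step_ofRel {V : Type u} {R : V → S.Op → List V → Prop}
    {hR : ∀ x o l o' l', R x o l → R x o' l' → o = o' ∧ l = l'}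
    {hl : ∀ x o l, R x o l → l.length = S.arity o} {x : V} {o : S.Op} {l : List V} :
    Step (ofRel V R hR hl) x o l ↔ R x o l := by
  constructor
  · rintro ⟨⟨⟨x', o', l'⟩, h⟩, hx, rfl, rfl⟩
    obtain rfl : x' = x := List.singleton_inj.1 hx
    exact h
  · exact fun h => ⟨⟨⟨x, o, l⟩, h⟩, rfl, rfl, rfl⟩

variable (S) in
/-- The forgetful functor sending a term graph to its set of nodes. -/
def nodes : TermGraph S ⥤ Type u where
  obj X := Node X
  map f := ↾(node f)

end TermGraph

/-! ### Words over a pullback of sets -/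

section Lists

lemma List.eq_of_map_eq_of_map_eq {α β γ : Type*} {p : α → β} {q : α → γ}
    (h : ∀ x y, p x = p y → q x = q y → x = y) :
    ∀ {l l' : List α}, l.map p = l'.map p → l.map q = l'.map q → l = l'
  | [], [], _, _ => rfl
  | [], _ :: _, h₁, _ => by simp at h₁
  | _ :: _, [], h₁, _ => by simp at h₁
  | x :: l, y :: l', h₁, h₂ => by
    rw [List.map_cons, List.map_cons, List.cons.injEq] at h₁ h₂
    rw [h x y h₁.1 h₂.1, List.eq_of_map_eq_of_map_eq h h₁.2 h₂.2]

lemma List.exists_map_eq_map_eq {α β γ δ : Type*} {p : α → β} {q : α → γ} {f : β → δ} {g : γ → δ}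
    (h : ∀ x y, f x = g y → ∃ a, p a = x ∧ q a = y) :
    ∀ {l : List β} {l' : List γ}, l.map f = l'.map g → ∃ l₀ : List α, l₀.map p = l ∧ l₀.map q = l'
  | [], [], _ => ⟨[], rfl, rfl⟩
  | [], _ :: _, h₁ => by simp at h₁
  | _ :: _, [], h₁ => by simp at h₁
  | x :: l, y :: l', h₁ => by
    rw [List.map_cons, List.map_cons, List.cons.injEq] at h₁
    obtain ⟨a, rfl, rfl⟩ := h x y h₁.1
    obtain ⟨l₀, rfl, rfl⟩ := List.exists_map_eq_map_eq h h₁.2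
    exact ⟨a :: l₀, rfl, rfl⟩

end Lists

namespace TermGraph

variable {S : AlgebraicSignature.{u}}

/-! ### Pullbacks, computed on nodes -/

section Pullbacks

variable {P X Y Z : TermGraph S} {p : P ⟶ X} {q : P ⟶ Y} {f : X ⟶ Z} {g : Y ⟶ Z}

lemma node_w {p : P ⟶ X} {q : P ⟶ Y} {f : X ⟶ Z} {g : Y ⟶ Z} (h : p ≫ f = q ≫ g) (x : Node P) :
    node f (node p x) = node g (node q x) :=
  congrArg (fun k => node k x) h

lemma hom_w (h : ∀ x, node f (node p x) = node g (node q x)) : p ≫ f = q ≫ g :=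
  hom_ext h

lemma isPullback_nodes_iff :
    IsPullback ((nodes S).map p) ((nodes S).map q) ((nodes S).map f) ((nodes S).map g) ↔
      (∀ x, node f (node p x) = node g (node q x)) ∧
      (∀ x y, node p x = node p y → node q x = node q y → x = y) ∧
      ∀ x y, node f x = node g y → ∃ a, node p a = x ∧ node q a = y := by
  rw [Types.isPullback_iff]
  exact ⟨fun h => ⟨fun x => ConcreteCategory.congr_hom h.1 x, fun x y h₁ h₂ => h.2.1 x y ⟨h₁, h₂⟩,
    h.2.2⟩, fun h => ⟨ConcreteCategory.hom_ext _ _ h.1, fun x y h' => h.2.1 x y h'.1 h'.2, h.2.2⟩⟩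

lemma isPullback_of_nodes
    (h : IsPullback ((nodes S).map p) ((nodes S).map q) ((nodes S).map f) ((nodes S).map g))
    (hd : ∀ x, Defined X (node p x) → Defined Y (node q x) → Defined P x) :
    IsPullback p q f g := by
  obtain ⟨hw, hext, hex⟩ := isPullback_nodes_iff.1 h
  have key : ∀ s : PullbackCone f g, ∃ k : s.pt ⟶ P, k ≫ p = s.fst ∧ k ≫ q = s.snd := by
    intro s
    have : ∀ x : Node s.pt, ∃ y : Node P, node p y = node s.fst x ∧ node q y = node s.snd x :=
      fun x => hex _ _ (node_w s.condition x)
    choose k h₁ h₂ using this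
    refine ⟨homMk k ?_, hom_ext fun x => ?_, hom_ext fun x => ?_⟩
    · intro x o l hx
      have hX := hx.map s.fst
      have hY := hx.map s.snd
      have hk := hd (k x) (by rw [h₁]; exact hX.defined) (by rw [h₂]; exact hY.defined)
      rw [← h₁] at hX
      rw [← h₂] at hY
      obtain ⟨l₁, hl₁, e₁⟩ := hk.step_of_map hX
      obtain ⟨l₂, hl₂, e₂⟩ := hk.step_of_map hY
      obtain rfl := (hl₁.functional hl₂).2
      -- Both words have the same projections, and the projections are jointly injective.
      have : l.map k = l₁ := List.eq_of_map_eq_of_map_eq hext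
        (by rw [e₁, List.map_map]; exact List.map_congr_left fun x _ => h₁ x)
        (by rw [e₂, List.map_map]; exact List.map_congr_left fun x _ => h₂ x)
      rwa [this]
    · rw [node_comp, node_homMk, h₁]
    · rw [node_comp, node_homMk, h₂]
  choose k h₁ h₂ using key
  refine ⟨⟨hom_w hw⟩,
    ⟨PullbackCone.IsLimit.mk _ k h₁ h₂ fun s m hm₁ hm₂ => hom_ext fun x => hext _ _ ?_ ?_⟩⟩
  · exact congrArg (node · x) (hm₁.trans (h₁ s).symm)
  · exact congrArg (node · x) (hm₂.trans (h₂ s).symm)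

variable (f g) in
lemma exists_isPullback_nodes : ∃ (P : TermGraph S) (p : P ⟶ X) (q : P ⟶ Y),
    IsPullback ((nodes S).map p) ((nodes S).map q) ((nodes S).map f) ((nodes S).map g) ∧
      ∀ x, Defined X (node p x) → Defined Y (node q x) → Defined P x := by
  let V : Type u := { a : Node X × Node Y // node f a.1 = node g a.2 }
  let a : V → Node X := fun x => x.1.1
  let b : V → Node Y := fun x => x.1.2
  have hext : ∀ x y : V, a x = a y → b x = b y → x = y :=
    fun x y h₁ h₂ => Subtype.ext (Prod.ext h₁ h₂)
  let P : TermGraph S := ofRel V (fun x o l => Step X (a x) o (l.map a) ∧ Step Y (b x) o (l.map b))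
    (fun x o l o' l' h h' => ⟨(h.1.functional h'.1).1,
      List.eq_of_map_eq_of_map_eq hext (h.1.functional h'.1).2 (h.2.functional h'.2).2⟩)
    (fun x o l h => by simpa using h.1.length)
  let p : P ⟶ X := homMk a fun x o l h => (step_ofRel.1 h).1
  let q : P ⟶ Y := homMk b fun x o l h => (step_ofRel.1 h).2
  have hp : ∀ x, node p x = a x := node_homMk _ _
  have hq : ∀ x, node q x = b x := node_homMk _ _
  refine ⟨P, p, q, ?_, fun x h₁ h₂ => ?_⟩
  · refine isPullback_nodes_iff.2 ⟨fun x => ?_, fun x y h₁ h₂ => ?_, fun x y h => ?_⟩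
    · rw [hp, hq]
      exact x.2
    · rw [hp, hp] at h₁
      rw [hq, hq] at h₂
      exact hext _ _ h₁ h₂
    · exact ⟨⟨(x, y), h⟩, hp _, hq _⟩
  · rw [hp] at h₁
    rw [hq] at h₂
    obtain ⟨o, l, h₁⟩ := h₁
    obtain ⟨o', l', h₂⟩ := h₂
    -- Both edges land on the same node of `Z`, so labels agree and the two source words have equal
    -- images; they lift to a word of pairs.
    have h₃ := h₁.map f
    rw [show node f (a x) = node g (b x) from x.2] at h₃
    obtain ⟨rfl, e⟩ := h₃.functional (h₂.map g)
    obtain ⟨l₀, rfl, rfl⟩ := List.exists_map_eq_map_eq (p := a) (q := b)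
      (fun x y h => ⟨⟨(x, y), h⟩, rfl, rfl⟩) e
    exact ⟨o, l₀, step_ofRel.2 ⟨h₁, h₂⟩⟩

instance : HasPullbacks (TermGraph S) :=
  have (X Y Z : TermGraph S) (f : X ⟶ Z) (g : Y ⟶ Z) : HasPullback f g := by
    obtain ⟨P, p, q, h, hd⟩ := exists_isPullback_nodes f g
    exact (isPullback_of_nodes h hd).hasPullback
  hasPullbacks_of_hasLimit_cospan _

/-- Any pullback is isomorphic to the constructed one, and isomorphisms transport both conditions.
-/
lemma isPullback_iff : IsPullback p q f g ↔
    IsPullback ((nodes S).map p) ((nodes S).map q) ((nodes S).map f) ((nodes S).map g) ∧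
      ∀ x, Defined X (node p x) → Defined Y (node q x) → Defined P x := by
  refine ⟨fun h => ?_, fun h => isPullback_of_nodes h.1 h.2⟩
  obtain ⟨P', p', q', h', hd⟩ := exists_isPullback_nodes f g
  let e : P ≅ P' := h.isoIsPullback _ _ (isPullback_of_nodes h' hd)
  have he₁ : e.hom ≫ p' = p := h.isoIsPullback_hom_fst _ _ _
  have he₂ : e.hom ≫ q' = q := h.isoIsPullback_hom_snd _ _ _
  refine ⟨h'.of_iso ((nodes S).mapIso e.symm) (Iso.refl _) (Iso.refl _) (Iso.refl _) ?_ ?_ ?_ ?_,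
    fun x h₁ h₂ => ?_⟩
  · simp [← Functor.map_comp, ← he₁]
  · simp [← Functor.map_comp, ← he₂]
  · simp
  · simp
  · rw [← he₁, node_comp] at h₁
    rw [← he₂, node_comp] at h₂
    have := (hd _ h₁ h₂).map e.inv
    rwa [node_hom_inv] at this

end Pullbacks

end TermGraph

/-! ### Pushouts of sets along injections -/

namespace CategoryTheory.Limits.Types

variable {X₁ X₂ X₃ X₄ : Type u} {t : X₁ ⟶ X₂} {l : X₁ ⟶ X₃} {r : X₂ ⟶ X₄} {b : X₃ ⟶ X₄}

lemma injective_of_isPushout (h : IsPushout t l r b) (ht : Function.Injective t) :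
    Function.Injective b :=
  pushoutCocone_inr_injective_of_isColimit h.isColimit ht

lemma exists_of_isPushout (h : IsPushout t l r b) (ht : Function.Injective t) {x : X₂} {y : X₃}
    (hxy : r x = b y) : ∃ a, t a = x ∧ l a = y :=
  (pushoutCocone_inl_eq_inr_iff_of_isColimit h.isColimit ht x y).1 hxy

/-- In a pushout square of types, the map opposite to `l` is injective away from the range
of `t`. -/
lemma eq_of_isPushout (h : IsPushout t l r b) {x y : X₂} (hx : ∀ a, t a ≠ x) (hxy : r x = r y) :
    x = y := by
  -- The indicator of `x` vanishes on the range of `t`, so with the constant `False` it descends to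
  -- the pushout and separates `x` from other points.
  let k : X₂ ⟶ ULift.{u} Prop := ↾fun z => ⟨z = x⟩
  let k' : X₃ ⟶ ULift.{u} Prop := ↾fun _ => ⟨False⟩
  have hk : t ≫ k = l ≫ k' := by
    ext a
    exact iff_of_false (hx a) id
  have hd : ∀ z, h.desc k k' hk (r z) = ⟨z = x⟩ :=
    fun z => ConcreteCategory.congr_hom (h.inl_desc k k' hk) z
  have := ULift.up.inj ((hd x).symm.trans ((congrArg _ hxy).trans (hd y)))
  exact (this.mp rfl).symm

end CategoryTheory.Limits.Types

namespace TermGraph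

variable {S : AlgebraicSignature.{u}}

/-- A morphism of term graphs is full if it is injective on nodes and reflects definedness. -/
structure IsFull {X Y : TermGraph S} (f : X ⟶ Y) : Prop where
  injective : Function.Injective (node f)
  reflects : ∀ x, Defined Y (node f x) → Defined X x

/-! ### Pushouts along full morphisms -/

section Pushouts

variable {A B C D : TermGraph S} {m : A ⟶ C} {n : A ⟶ B} {g : C ⟶ D} {f : B ⟶ D}

/-- Every hyperedge of `D` comes from a hyperedge of `C` or from one of `B`. -/
def Covers (g : C ⟶ D) (f : B ⟶ D) : Prop :=
  ∀ d, Defined D d → (∃ c, Defined C c ∧ node g c = d) ∨ ∃ b, Defined B b ∧ node f b = d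

lemma isPushout_of_nodes
    (h : IsPushout ((nodes S).map m) ((nodes S).map n) ((nodes S).map g) ((nodes S).map f))
    (hc : Covers g f) : IsPushout m n g f := by
  have key : ∀ s : PushoutCocone m n, ∃ k : D ⟶ s.pt, g ≫ k = s.inl ∧ f ≫ k = s.inr := by
    intro s
    have hs : (nodes S).map m ≫ (nodes S).map s.inl = (nodes S).map n ≫ (nodes S).map s.inr := by
      rw [← Functor.map_comp, ← Functor.map_comp, s.condition]
    let k : Node D → Node s.pt := h.desc _ _ hs
    have h₁ : ∀ c, k (node g c) = node s.inl c :=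
      fun c => ConcreteCategory.congr_hom (h.inl_desc _ _ hs) c
    have h₂ : ∀ b, k (node f b) = node s.inr b :=
      fun b => ConcreteCategory.congr_hom (h.inr_desc _ _ hs) b
    refine ⟨homMk k ?_, hom_ext fun x => ?_, hom_ext fun x => ?_⟩
    · intro d o l hd
      obtain ⟨c, hc, rfl⟩ | ⟨b, hb, rfl⟩ := hc d hd.defined
      · obtain ⟨l, hl, rfl⟩ := hc.step_of_map hd
        rw [h₁, List.map_map, show k ∘ node g = node s.inl from funext h₁]
        exact hl.map s.inl
      · obtain ⟨l, hl, rfl⟩ := hb.step_of_map hd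
        rw [h₂, List.map_map, show k ∘ node f = node s.inr from funext h₂]
        exact hl.map s.inr
    · rw [node_comp, node_homMk, h₁]
    · rw [node_comp, node_homMk, h₂]
  choose k h₁ h₂ using key
  refine ⟨⟨hom_ext fun x => ConcreteCategory.congr_hom h.w x⟩,
    ⟨PushoutCocone.IsColimit.mk _ k h₁ h₂ fun s u hu₁ hu₂ => hom_ext fun x => ?_⟩⟩
  obtain ⟨c, rfl⟩ | ⟨b, rfl⟩ := Types.eq_or_eq_of_isPushout h x
  · exact congrArg (node · c) (hu₁.trans (h₁ s).symm)
  · exact congrArg (node · b) (hu₂.trans (h₂ s).symm)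

lemma exists_isPushout_nodes (hm : IsFull m) (n : A ⟶ B) :
    ∃ (D : TermGraph S) (g : C ⟶ D) (f : B ⟶ D),
      IsPushout ((nodes S).map m) ((nodes S).map n) ((nodes S).map g) ((nodes S).map f) ∧
        Covers g f := by
  obtain ⟨V, g₀, f₀, hV⟩ : ∃ (V : Type u) (g₀ : (nodes S).obj C ⟶ V) (f₀ : (nodes S).obj B ⟶ V),
      IsPushout ((nodes S).map m) ((nodes S).map n) g₀ f₀ :=
    ⟨_, _, _, IsPushout.of_hasPushout _ _⟩
  let g' : Node C → V := g₀
  let f' : Node B → V := f₀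
  have hw : ∀ a, g' (node m a) = f' (node n a) := fun a => ConcreteCategory.congr_hom hV.w a
  have hinj : Function.Injective f' := Types.injective_of_isPushout hV hm.injective
  have hgf : ∀ c b, g' c = f' b → ∃ a, node m a = c ∧ node n a = b :=
    fun c b h => Types.exists_of_isPushout hV hm.injective h
  have hgg : ∀ c c', (∀ a, node m a ≠ c) → g' c = g' c' → c = c' :=
    fun c c' hc h => Types.eq_of_isPushout hV hc h
  -- From `C` only edges with target outside the image of `m` are added: by fullness the others come
  -- from `A`, hence already appear through `B`. This keeps the relation functional.
  let RB : V → S.Op → List V → Prop := fun d o l => ∃ b lb, Step B b o lb ∧ f' b = d ∧ lb.map f' = l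
  let RC : V → S.Op → List V → Prop := fun d o l => ∃ c lc, (∀ a, node m a ≠ c) ∧
    Step C c o lc ∧ g' c = d ∧ lc.map g' = l
  have hBB : ∀ d o l o' l', RB d o l → RB d o' l' → o = o' ∧ l = l' := by
    rintro d o l o' l' ⟨b, lb, h, rfl, rfl⟩ ⟨b', lb', h', e, rfl⟩
    obtain rfl := hinj e
    obtain ⟨rfl, rfl⟩ := h.functional h'
    exact ⟨rfl, rfl⟩
  have hCC : ∀ d o l o' l', RC d o l → RC d o' l' → o = o' ∧ l = l' := by
    rintro d o l o' l' ⟨c, lc, hc, h, rfl, rfl⟩ ⟨c', lc', hc', h', e, rfl⟩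
    obtain rfl := hgg _ _ hc' e
    obtain ⟨rfl, rfl⟩ := h.functional h'
    exact ⟨rfl, rfl⟩
  have hCB : ∀ d o l o' l', RC d o l → ¬ RB d o' l' := by
    rintro d o l o' l' ⟨c, lc, hc, h, rfl, rfl⟩ ⟨b, lb, h', e, rfl⟩
    obtain ⟨a, ha, -⟩ := hgf _ _ e.symm
    exact hc a ha
  let D : TermGraph S := ofRel V (fun d o l => RB d o l ∨ RC d o l)
    (by
      rintro d o l o' l' (h | h) (h' | h')
      · exact hBB _ _ _ _ _ h h'
      · exact (hCB _ _ _ _ _ h' h).elim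
      · exact (hCB _ _ _ _ _ h h').elim
      · exact hCC _ _ _ _ _ h h')
    (by
      rintro d o l (⟨b, lb, h, -, rfl⟩ | ⟨c, lc, -, h, -, rfl⟩)
      · rw [List.length_map, h.length]
      · rw [List.length_map, h.length])
  let f : B ⟶ D := homMk f' fun b o l h => step_ofRel.2 (Or.inl ⟨b, l, h, rfl, rfl⟩)
  let g : C ⟶ D := homMk g' fun c o l h => step_ofRel.2 (by
    by_cases hc : ∃ a, node m a = c
    · obtain ⟨a, rfl⟩ := hc
      obtain ⟨l, hl, rfl⟩ := (hm.reflects a h.defined).step_of_map h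
      refine Or.inl ⟨node n a, _, hl.map n, (hw a).symm, ?_⟩
      exact (List.map_map.trans (List.map_congr_left fun a _ => (hw a).symm)).trans
        List.map_map.symm
    · exact Or.inr ⟨c, l, fun a ha => hc ⟨a, ha⟩, h, rfl, rfl⟩)
  have hf : ∀ b, node f b = f' b := node_homMk _ _
  have hg : ∀ c, node g c = g' c := node_homMk _ _
  refine ⟨D, g, f, ?_, ?_⟩
  · have hf₀ : (nodes S).map f = f₀ := ConcreteCategory.hom_ext _ _ hf
    have hg₀ : (nodes S).map g = g₀ := ConcreteCategory.hom_ext _ _ hg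
    rw [hf₀, hg₀]
    exact hV
  · rintro d ⟨o, l, h⟩
    obtain ⟨b, lb, h, hd, -⟩ | ⟨c, lc, -, h, hd, -⟩ := step_ofRel.1 h
    · exact Or.inr ⟨b, h.defined, (hf b).trans hd⟩
    · exact Or.inl ⟨c, h.defined, (hg c).trans hd⟩

lemma hasPushout_of_isFull (hm : IsFull m) (n : A ⟶ B) : HasPushout m n := by
  obtain ⟨D, g, f, h, hc⟩ := exists_isPushout_nodes hm n
  exact (isPushout_of_nodes h hc).hasPushout

lemma isPushout_iff (hm : IsFull m) : IsPushout m n g f ↔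
    IsPushout ((nodes S).map m) ((nodes S).map n) ((nodes S).map g) ((nodes S).map f) ∧
      Covers g f := by
  refine ⟨fun h => ?_, fun h => isPushout_of_nodes h.1 h.2⟩
  obtain ⟨D', g', f', h', hc⟩ := exists_isPushout_nodes hm n
  let e : D' ≅ D := (isPushout_of_nodes h' hc).isoIsPushout _ _ h
  have he₁ : g' ≫ e.hom = g := IsPushout.inl_isoIsPushout_hom _ _ _ _
  have he₂ : f' ≫ e.hom = f := IsPushout.inr_isoIsPushout_hom _ _ _ _
  refine ⟨h'.of_iso (Iso.refl _) (Iso.refl _) (Iso.refl _) ((nodes S).mapIso e) ?_ ?_ ?_ ?_,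
    fun d hd => ?_⟩
  · simp
  · simp
  · simp [← Functor.map_comp, ← he₁]
  · simp [← Functor.map_comp, ← he₂]
  · obtain ⟨c, hc, hd'⟩ | ⟨b, hb, hd'⟩ := hc _ (hd.map e.inv)
    · exact Or.inl ⟨c, hc, by rw [← he₁, node_comp, hd', node_inv_hom]⟩
    · exact Or.inr ⟨b, hb, by rw [← he₂, node_comp, hd', node_inv_hom]⟩

lemma IsFull.of_isPushout (hm : IsFull m) (h : IsPushout m n g f) : IsFull f := by
  obtain ⟨h, hc⟩ := (isPushout_iff hm).1 h
  have hf : Function.Injective (node f) := Types.injective_of_isPushout h hm.injective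
  refine ⟨hf, fun b hb => ?_⟩
  obtain ⟨c, hc, hd⟩ | ⟨b', hb', hd⟩ := hc _ hb
  · obtain ⟨a, rfl, rfl⟩ := Types.exists_of_isPushout h hm.injective hd
    exact (hm.reflects a hc).map n
  · rwa [← hf hd]

end Pushouts

/-! ### Regular monomorphisms are the full morphisms -/

/-- The term graph with a single node and no hyperedge. -/
def point (S : AlgebraicSignature.{u}) : TermGraph S :=
  ofRel PUnit (fun _ _ _ => False) (fun _ _ _ _ _ h => h.elim) (fun _ _ _ h => h.elim)

lemma exists_point_hom {X : TermGraph S} (x : Node X) :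
    ∃ f : point S ⟶ X, ∀ y, node f y = x :=
  ⟨homMk (fun _ => x) fun _ _ _ h => (step_ofRel.1 h).elim, node_homMk _ _⟩

/-- Maps out of `point S` are the same as nodes. -/
lemma injective_node_of_mono {X Y : TermGraph S} (f : X ⟶ Y) [Mono f] :
    Function.Injective (node f) := by
  intro x y h
  obtain ⟨a, ha⟩ := exists_point_hom x
  obtain ⟨b, hb⟩ := exists_point_hom y
  have : a = b := by
    rw [← cancel_mono f]
    exact hom_ext fun z => by rw [node_comp, node_comp, ha, hb, h]
  rw [← ha PUnit.unit, ← hb PUnit.unit, this]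

/-- If `f` and `g` agree on a defined node, uniqueness of the edge at its image makes them agree on
the sources too, so the whole edge lies in the equalizer. Factoring `k` through a regular
monomorphism shows that the latter reflects definedness. -/
lemma exists_full_equalizing {Y Z : TermGraph S} (f g : Y ⟶ Z) :
    ∃ (W : TermGraph S) (k : W ⟶ Y), k ≫ f = k ≫ g ∧
      ∀ y, node f y = node g y → Defined Y y → ∃ x, node k x = y ∧ Defined W x := by
  let V : Type u := { y : Node Y // node f y = node g y }
  let W : TermGraph S := ofRel V (fun x o l => Step Y x.1 o (l.map Subtype.val))
    (fun x o l o' l' h h' => ⟨(h.functional h').1,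
      List.map_injective_iff.2 Subtype.val_injective (h.functional h').2⟩)
    (fun x o l h => by simpa using h.length)
  let k : W ⟶ Y := homMk (fun x : V => x.1) fun x o l h => (step_ofRel.1 h :)
  have hk : ∀ x, node k x = x.1 := node_homMk _ _
  refine ⟨W, k, hom_ext fun x => ?_, fun y hy => ?_⟩
  · rw [node_comp, node_comp, hk]
    exact x.2
  · rintro ⟨o, l, h⟩
    have h' := h.map f
    rw [hy] at h'
    have hl := List.map_inj_left.1 (h'.functional (h.map g)).2
    lift l to List V using hl with l
    exact ⟨⟨y, hy⟩, hk _, o, l, step_ofRel.2 h⟩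

lemma IsFull.exists_lift {X Y W : TermGraph S} {m : X ⟶ Y} (hm : IsFull m) (k : W ⟶ Y)
    (hk : ∀ w, ∃ x, node m x = node k w) : ∃ l : W ⟶ X, l ≫ m = k := by
  choose l hl using hk
  refine ⟨homMk l fun w o s h => ?_, hom_ext fun w => by rw [node_comp, node_homMk, hl]⟩
  have h' := h.map k
  rw [← hl] at h'
  obtain ⟨s', hs', e⟩ := (hm.reflects _ h'.defined).step_of_map h'
  rw [← show node m ∘ l = node k from funext hl, ← List.map_map] at e
  rwa [← List.map_injective_iff.2 hm.injective e]

lemma IsFull.mono {X Y : TermGraph S} {m : X ⟶ Y} (hm : IsFull m) : Mono m :=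
  ⟨fun _ _ h => hom_ext fun x => hm.injective (congrArg (node · x) h)⟩

lemma isFull_of_isRegularMono {X Y : TermGraph S} (m : X ⟶ Y) [IsRegularMono m] : IsFull m := by
  have : Mono m := (IsRegularMono.getStruct m).mono
  have hm := injective_node_of_mono m
  refine ⟨hm, fun x hx => ?_⟩
  obtain ⟨W, k, hk, hW⟩ := exists_full_equalizing (IsRegularMono.left m) (IsRegularMono.right m)
  obtain ⟨w, hw, hd⟩ := hW (node m x) (node_w (IsRegularMono.w m) x) hx
  have e : node m (node (IsRegularMono.lift m k hk) w) = node m x := by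
    rw [← node_comp, IsRegularMono.fac m k hk, hw]
  rw [← hm e]
  exact hd.map _

lemma IsFull.isRegularMono {X Y : TermGraph S} {m : X ⟶ Y} (hm : IsFull m) :
    IsRegularMono m := by
  -- The cokernel pair of `m`: its two legs agree only on the image of `m`.
  obtain ⟨D, g, f, h, hc⟩ := exists_isPushout_nodes hm m
  have hw : m ≫ g = m ≫ f := hom_ext fun x => ConcreteCategory.congr_hom h.w x
  have key : ∀ s : Fork g f, ∃ l : s.pt ⟶ X, l ≫ m = s.ι := by
    refine fun s => hm.exists_lift _ fun w => ?_
    obtain ⟨a, ha, -⟩ := Types.exists_of_isPushout h hm.injective (node_w s.condition w)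
    exact ⟨a, ha⟩
  choose l hl using key
  have := hm.mono
  exact ⟨⟨⟨D, g, f, hw, Fork.IsLimit.mk _ l hl fun s k hk => by
    rw [← cancel_mono m, hl]
    exact hk⟩⟩⟩

lemma isRegularMono_iff {X Y : TermGraph S} (m : X ⟶ Y) : IsRegularMono m ↔ IsFull m :=
  ⟨fun _ => isFull_of_isRegularMono m, fun h => h.isRegularMono⟩

lemma IsFull.comp {X Y Z : TermGraph S} {f : X ⟶ Y} {g : Y ⟶ Z} (hf : IsFull f)
    (hg : IsFull g) : IsFull (f ≫ g) :=
  ⟨hg.injective.comp hf.injective, fun x h => hf.reflects x (hg.reflects _ h)⟩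

lemma IsFull.of_comp {X Y Z : TermGraph S} {f : X ⟶ Y} {g : Y ⟶ Z} (h : IsFull (f ≫ g)) :
    IsFull f :=
  ⟨Function.Injective.of_comp (f := node g) h.injective, fun x hx => h.reflects x (hx.map g)⟩

lemma IsFull.of_isPullback {P X Y Z : TermGraph S} {p : P ⟶ X} {q : P ⟶ Y} {f : X ⟶ Z}
    {g : Y ⟶ Z} (h : IsPullback p q f g) (hg : IsFull g) : IsFull p := by
  obtain ⟨h, hd⟩ := isPullback_iff.1 h
  obtain ⟨hw, hext, -⟩ := isPullback_nodes_iff.1 h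
  refine ⟨fun x y hxy => hext _ _ hxy (hg.injective ?_), fun x hx => hd _ hx (hg.reflects _ ?_)⟩
  · rw [← hw, ← hw, hxy]
  · rw [← hw]
    exact hx.map f

/-! ### The Van Kampen property -/

lemma isVanKampen_of_isFull {A B C D : TermGraph S} {m : A ⟶ C} {n : A ⟶ B} {g : C ⟶ D}
    {f : B ⟶ D} (H : IsPushout m n g f) (hm : IsFull m) : H.IsVanKampen := by
  intro A' C' B' D' m' n' g' f' α γ β δ hm' hn' hg' hf' hw
  have hfull : IsFull m' := hm.of_isPullback hm'
  obtain ⟨hN, hC⟩ := (isPushout_iff hm).1 H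
  obtain ⟨hmN, hmd⟩ := isPullback_iff.1 hm'
  obtain ⟨hnN, hnd⟩ := isPullback_iff.1 hn'
  have : Mono ((nodes S).map m) := (mono_iff_injective _).2 hm.injective
  have VK := Adhesive.van_kampen hN _ _ _ _ _ _ _ _ hmN hnN (hg'.map (nodes S))
    (hf'.map (nodes S)) (hw.map (nodes S))
  constructor
  · intro h
    have hf : IsFull f' := hfull.of_isPushout h
    obtain ⟨hN', hC'⟩ := (isPushout_iff hfull).1 h
    obtain ⟨hgN, hfN⟩ := VK.1 hN'
    refine ⟨isPullback_iff.2 ⟨hgN, fun c hc hγ => ?_⟩,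
      isPullback_iff.2 ⟨hfN, fun b hb _ => hf.reflects b hb⟩⟩
    -- On the image of `m'`, fullness of `f'` and `m` and the back face over `n` make `a` defined.
    -- Off it, `g'` is injective and avoids the image of `f'`, so the edge at `g' c` must come from
    -- `c`.
    by_cases hca : ∃ a, node m' a = c
    · obtain ⟨a, rfl⟩ := hca
      refine Defined.map m' (hnd a (hf.reflects _ ?_) (hm.reflects _ ?_))
      · rwa [← node_w hw.w]
      · rwa [← node_w hm'.w]
    · have hca' : ∀ a, node m' a ≠ c := fun a ha => hca ⟨a, ha⟩
      obtain ⟨c', hc', e⟩ | ⟨b, hb, e⟩ := hC' _ hc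
      · rwa [Types.eq_of_isPushout hN' hca' e.symm]
      · obtain ⟨a, ha, -⟩ := Types.exists_of_isPushout hN' hfull.injective e.symm
        exact (hca ⟨a, ha⟩).elim
  · rintro ⟨hg, hf⟩
    obtain ⟨hgN, hgd⟩ := isPullback_iff.1 hg
    obtain ⟨hfN, hfd⟩ := isPullback_iff.1 hf
    refine (isPushout_iff hfull).2 ⟨VK.2 ⟨hgN, hfN⟩, fun d hd => ?_⟩
    -- The edge below `d` comes from `C` or `B`; the corresponding front pullback lifts its target
    -- to a defined node over `d`.
    obtain ⟨c, hc, e⟩ | ⟨b, hb, e⟩ := hC _ (hd.map δ)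
    · obtain ⟨c', rfl, rfl⟩ := (isPullback_nodes_iff.1 hgN).2.2 _ _ e.symm
      exact Or.inl ⟨c', hgd _ hd hc, rfl⟩
    · obtain ⟨b', rfl, rfl⟩ := (isPullback_nodes_iff.1 hfN).2.2 _ _ e.symm
      exact Or.inr ⟨b', hfd _ hd hb, rfl⟩

end TermGraph

theorem mainTheorem11 (S : AlgebraicSignature.{u}) : IsQuasiAdhesive (TermGraph S) where
  mono _ _ f hf := have : IsRegularMono f := hf; (IsRegularMono.getStruct f).mono
  isos_left _ _ f hf := have : IsIso f := hf; ⟨⟨RegularMono.ofIso (asIso f)⟩⟩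
  isos_right := le_top
  comp_left := ⟨fun f g hf hg => (TermGraph.isRegularMono_iff _).2
    (((TermGraph.isRegularMono_iff f).1 hf).comp ((TermGraph.isRegularMono_iff g).1 hg))⟩
  comp_right := inferInstance
  decomp_left := ⟨fun f g _ hfg => (TermGraph.isRegularMono_iff f).2
    ((TermGraph.isRegularMono_iff (f ≫ g)).1 hfg).of_comp⟩
  decomp_right := ⟨fun _ _ _ _ => trivial⟩
  decomp_right_left := ⟨fun _ _ _ _ => trivial⟩
  pullback_left := ⟨fun sq hg => (TermGraph.isRegularMono_iff _).2
    (((TermGraph.isRegularMono_iff _).1 hg).of_isPullback sq.flip)⟩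
  pullback_right := inferInstance
  pushout_left := ⟨fun sq hf => (TermGraph.isRegularMono_iff _).2
    (((TermGraph.isRegularMono_iff _).1 hf).of_isPushout sq.flip)⟩
  pushout_right := inferInstance
  hasPullback _ _ _ := inferInstance
  hasPushout m n hm _ := TermGraph.hasPushout_of_isFull ((TermGraph.isRegularMono_iff m).1 hm) n
  vanKampen {_ _ _ _ m _ _ _} H hm _ :=
    TermGraph.isVanKampen_of_isFull H ((TermGraph.isRegularMono_iff m).1 hm)
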